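/- All graphs are finite, simple, undirected and connected. For a graph $G$ let $$AZI(G)=\sum_{uv\in E(G)}\left(\frac{d_u d_v}{d_u+d_v-2}\right)^3$$ be its augmented Zagreb index, where $d_u$ denotes the degree of the vertex $u$. A cactus is a connected graph in which every edge lies on at most one cycle. Let $G$ be a cactus with $n\ge 4$ vertices. Then $$AZI(G)\ \ge\ (n-1)\left(\frac{n-1}{n-2}\right)^3,$$ and equality holds if and only if $G$ is isomorphic to the star $S_n$ on $n$ vertices. -/

import Mathlib

/-- The augmented Zagreb index
`∑_{uv ∈ E(G)} (d_u d_v / (d_u + d_v - 2)) ^ 3` of a finite graph (the arithmetic is in `ℝ`). -/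
noncomputable def augmentedZagrebIndex {V : Type*} [Fintype V] [DecidableEq V]
    (G : SimpleGraph V) [DecidableRel G.Adj] : ℝ :=
  ∑ e ∈ G.edgeFinset,
    Sym2.lift ⟨fun u v : V =>
      (((G.degree u : ℝ) * (G.degree v : ℝ)) / ((G.degree u : ℝ) + (G.degree v : ℝ) - 2)) ^ 3,
      fun u v => by
        simp only [mul_comm (G.degree u : ℝ), add_comm (G.degree u : ℝ)]⟩ e

/-- A cactus: a connected graph in which every edge lies on at most one cycle. Two closed walks
that traverse the same cycle from different base points or in different directions are the
same cycle, so cycles are compared as subgraphs. -/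
def IsCactus {V : Type*} (G : SimpleGraph V) : Prop :=
  G.Connected ∧
    ∀ (e : Sym2 V) (u v : V) (p : G.Walk u u) (q : G.Walk v v),
      p.IsCycle → q.IsCycle → e ∈ p.edges → e ∈ q.edges → p.toSubgraph = q.toSubgraph

/-!
A connected graph on `n` vertices has at least `n - 1` edges. When `n ≥ 3` no edge `uv` joins two
leaves, and then `d_u d_v / (d_u + d_v - 2) ≥ (n - 1) / (n - 2)`, strictly if both degrees are below
`n - 1`. Hence equality in the bound forces exactly `n - 1` edges, so that the graph is a tree, and
a vertex adjacent to all others; a tree with such a vertex is a star.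
-/

open SimpleGraph

section Arithmetic

variable {a b n : ℕ}

/-- The right-hand side is the cross-multiplied difference of `a b / (a + b - 2)` and
`(n - 1) / (n - 2)`. -/
theorem min_sub_one_sub_le (ha : 0 < a) (hb : 0 < b) (hn : 3 ≤ n) :
    min ((n : ℝ) - 1 - a) (n - 1 - b) ≤ a * b * (n - 2) - (n - 1) * (a + b - 2) := by
  have hb' : (1 : ℝ) ≤ b := by exact_mod_cast hb
  have hn' : (3 : ℝ) ≤ n := by exact_mod_cast hn
  obtain rfl | ha : a = 1 ∨ 2 ≤ a := by lia
  · refine (min_le_right _ _).trans_eq ?_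
    push_cast
    ring
  · have ha' : (2 : ℝ) ≤ a := by exact_mod_cast ha
    have hprod : 1 ≤ ((n : ℝ) - 2) * (a - 1) :=
      one_le_mul_of_one_le_of_one_le (by linarith) (by linarith)
    calc min ((n : ℝ) - 1 - a) (n - 1 - b) ≤ n - 1 - a := min_le_left _ _
      _ ≤ (n - 1 - a) + (b - 1) * ((n - 2) * (a - 1) - 1) :=
        le_add_of_nonneg_right (mul_nonneg (sub_nonneg.2 hb') (sub_nonneg.2 hprod))
      _ = a * b * (n - 2) - (n - 1) * (a + b - 2) := by ring

theorem sub_one_div_sub_two_le (ha : 0 < a) (hb : 0 < b) (hab : 3 ≤ a + b) (han : a < n)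
    (hbn : b < n) : ((n : ℝ) - 1) / (n - 2) ≤ a * b / (a + b - 2) := by
  have hn : 3 ≤ n := by lia
  have hab' : (3 : ℝ) ≤ a + b := by exact_mod_cast hab
  have han' : (a : ℝ) + 1 ≤ n := by exact_mod_cast han
  have hbn' : (b : ℝ) + 1 ≤ n := by exact_mod_cast hbn
  have hmin : 0 ≤ min ((n : ℝ) - 1 - a) (n - 1 - b) := le_min (by linarith) (by linarith)
  rw [div_le_div_iff₀ (by linarith) (by linarith)]
  exact sub_nonneg.1 (hmin.trans (min_sub_one_sub_le ha hb hn))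

theorem sub_one_div_sub_two_lt (ha : 0 < a) (hb : 0 < b) (hab : 3 ≤ a + b) (han : a < n - 1)
    (hbn : b < n - 1) : ((n : ℝ) - 1) / (n - 2) < a * b / (a + b - 2) := by
  have hn : 3 ≤ n := by lia
  have hab' : (3 : ℝ) ≤ a + b := by exact_mod_cast hab
  have han' : (a : ℝ) + 1 < n := by exact_mod_cast Nat.add_lt_of_lt_sub han
  have hbn' : (b : ℝ) + 1 < n := by exact_mod_cast Nat.add_lt_of_lt_sub hbn
  have hmin : 0 < min ((n : ℝ) - 1 - a) (n - 1 - b) := lt_min (by linarith) (by linarith)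
  rw [div_lt_div_iff₀ (by linarith) (by linarith)]
  exact sub_pos.1 (hmin.trans_le (min_sub_one_sub_le ha hb hn))

end Arithmetic

theorem card_eq_and_forall_eq_of_sum_le {ι R : Type*} [Semiring R] [LinearOrder R]
    [IsStrictOrderedRing R] {s : Finset ι} {f : ι → R} {c k : R} (hc : 0 < c)
    (hk : k ≤ s.card) (hf : ∀ i ∈ s, c ≤ f i) (hsum : ∑ i ∈ s, f i ≤ k * c) :
    (s.card : R) = k ∧ ∀ i ∈ s, f i = c := by
  have hcard : s.card * c ≤ ∑ i ∈ s, f i := by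
    simpa only [nsmul_eq_mul] using s.card_nsmul_le_sum f c hf
  have hk' : (s.card : R) = k := (le_of_mul_le_mul_right (hcard.trans hsum) hc).antisymm hk
  have hconst : ∑ _i ∈ s, c = ∑ i ∈ s, f i := by
    rw [Finset.sum_const, nsmul_eq_mul]
    exact hcard.antisymm (hk' ▸ hsum)
  exact ⟨hk', fun i hi => ((Finset.sum_eq_sum_iff_of_le hf).1 hconst i hi).symm⟩

section Star

variable {V W : Type*} {G : SimpleGraph V}

theorem eq_starGraph_of_isTree_of_isUniversal {z : V} (hG : G.IsTree) (hz : G.IsUniversal z) :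
    G = starGraph z := by
  have hle : starGraph z ≤ G := by
    rintro u v huv
    obtain ⟨hne, rfl | rfl⟩ := starGraph_adj.1 huv
    exacts [hz hne, (hz hne.symm).symm]
  exact (isTree_iff_minimal_connected.1 hG).eq_of_ge (connected_starGraph z) hle

theorem nonempty_iso_starGraph_iff (e : V ≃ W) (r : W) :
    Nonempty (G ≃g starGraph r) ↔ ∃ z, G = starGraph z := by
  classical
  constructor
  · rintro ⟨f⟩
    refine ⟨f.symm r, ?_⟩
    ext u v
    rw [← f.map_adj_iff, starGraph_adj, starGraph_adj, f.injective.ne_iff]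
    simp only [RelIso.eq_symm_apply]
  · rintro ⟨z, rfl⟩
    let e' : V ≃ W := e.setValue z r
    have he' : e' z = r := e.setValue_eq z r
    refine ⟨e', fun {u v} => ?_⟩
    rw [starGraph_adj, starGraph_adj, ← he', e'.injective.ne_iff, e'.injective.eq_iff,
      e'.injective.eq_iff]

end Star

section Index

variable {V : Type*} [Fintype V] {G : SimpleGraph V} [DecidableRel G.Adj]

theorem three_le_degree_add_degree (hG : G.Connected) (hV : 3 ≤ Fintype.card V) {u v : V}
    (huv : G.Adj u v) : 3 ≤ G.degree u + G.degree v := by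
  classical
  have hu := huv.degree_pos_left
  have hv := huv.degree_pos_right
  by_contra! hlt
  have hu₁ : G.degree u = 1 := by lia
  have hv₁ : G.degree v = 1 := by lia
  have : Nontrivial ↥({u}ᶜ : Set V) := by
    rw [← Fintype.one_lt_card_iff_nontrivial, Fintype.card_compl_set]
    rw [Set.card_singleton]
    lia
  obtain ⟨⟨w, hwu⟩, hvw⟩ :=
    (hG.induce_compl_singleton_of_degree_eq_one hu₁).preconnected.exists_adj_of_nontrivial
      ⟨v, huv.ne'⟩
  exact hwu ((degree_eq_one_iff_existsUnique_adj.1 hv₁).unique hvw huv.symm)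

/-- The summand of the augmented Zagreb index at an edge, as a function on all unordered pairs. -/
noncomputable def augmentedZagrebWeight (G : SimpleGraph V) [DecidableRel G.Adj] : Sym2 V → ℝ :=
  Sym2.lift ⟨fun u v => ((G.degree u * G.degree v : ℝ) / (G.degree u + G.degree v - 2)) ^ 3,
    fun u v => by simp only [mul_comm (G.degree u : ℝ), add_comm (G.degree u : ℝ)]⟩

theorem augmentedZagrebWeight_mk (u v : V) : augmentedZagrebWeight G s(u, v) =
    ((G.degree u * G.degree v : ℝ) / (G.degree u + G.degree v - 2)) ^ 3 :=
  rfl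

theorem augmentedZagrebIndex_eq_sum [DecidableEq V] :
    augmentedZagrebIndex G = ∑ e ∈ G.edgeFinset, augmentedZagrebWeight G e :=
  rfl

theorem le_augmentedZagrebWeight (hG : G.Connected) (hV : 3 ≤ Fintype.card V) {e : Sym2 V}
    (he : e ∈ G.edgeSet) :
    (((Fintype.card V : ℝ) - 1) / (Fintype.card V - 2)) ^ 3 ≤ augmentedZagrebWeight G e := by
  have hV' : (3 : ℝ) ≤ Fintype.card V := by exact_mod_cast hV
  cases e with | _ u v =>
  have huv : G.Adj u v := he
  exact pow_le_pow_left₀ (div_nonneg (by linarith) (by linarith))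
    (sub_one_div_sub_two_le huv.degree_pos_left huv.degree_pos_right
      (three_le_degree_add_degree hG hV huv) (G.degree_lt_card_verts u)
      (G.degree_lt_card_verts v)) 3

theorem exists_isUniversal_of_augmentedZagrebWeight_eq (hG : G.Connected)
    (hV : 3 ≤ Fintype.card V) {e : Sym2 V} (he : e ∈ G.edgeSet)
    (h : augmentedZagrebWeight G e = (((Fintype.card V : ℝ) - 1) / (Fintype.card V - 2)) ^ 3) :
    ∃ z, G.IsUniversal z := by
  have hV' : (3 : ℝ) ≤ Fintype.card V := by exact_mod_cast hV
  cases e with | _ u v =>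
  have huv : G.Adj u v := he
  by_contra! hz
  have hlt := sub_one_div_sub_two_lt huv.degree_pos_left huv.degree_pos_right
    (three_le_degree_add_degree hG hV huv) ((G.degree_lt_card_sub_one u).2 (hz u))
    ((G.degree_lt_card_sub_one v).2 (hz v))
  exact (pow_lt_pow_left₀ hlt (div_nonneg (by linarith) (by linarith)) three_ne_zero).ne' h

theorem card_sub_one_le_card_edgeFinset (hG : G.Connected) :
    (Fintype.card V : ℝ) - 1 ≤ G.edgeFinset.card := by
  have h := hG.card_vert_le_card_edgeSet_add_one
  rw [Nat.card_eq_fintype_card, Nat.card_eq_fintype_card, ← edgeFinset_card] at h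
  rw [sub_le_iff_le_add]
  exact_mod_cast h

theorem isTree_of_card_edgeFinset_eq (hG : G.Connected)
    (h : (G.edgeFinset.card : ℝ) = Fintype.card V - 1) : G.IsTree := by
  rw [eq_sub_iff_add_eq] at h
  rw [isTree_iff_connected_and_card, Nat.card_eq_fintype_card, Nat.card_eq_fintype_card,
    ← edgeFinset_card]
  exact ⟨hG, by exact_mod_cast h⟩

theorem augmentedZagrebWeight_starGraph {r : V} [DecidableRel (starGraph r).Adj] {e : Sym2 V}
    (he : e ∈ (starGraph r).edgeSet) : augmentedZagrebWeight (starGraph r) e =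
      (((Fintype.card V : ℝ) - 1) / (Fintype.card V - 2)) ^ 3 := by
  classical
  cases e with | _ u v =>
  have huv : (starGraph r).Adj u v := he
  wlog hu : u = r generalizing u v
  · rw [Sym2.eq_swap]
    exact this v u huv.symm huv.symm ((starGraph_adj.1 huv).2.resolve_left hu)
  subst hu
  have hdu : ((starGraph u).degree u : ℝ) = Fintype.card V - 1 := by
    rw [(degree_eq_card_sub_one _ u).2 isUniversal_starGraph_self,
      Nat.cast_pred (Fintype.card_pos_iff.2 ⟨u⟩)]
  have hdv : (starGraph u).degree v = 1 := by
    convert degree_starGraph_of_ne_center huv.ne'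
  rw [augmentedZagrebWeight_mk, hdu, hdv, Nat.cast_one, mul_one]
  congr 2
  ring

variable [DecidableEq V]

theorem augmentedZagrebIndex_starGraph (r : V) [DecidableRel (starGraph r).Adj] :
    augmentedZagrebIndex (starGraph r) =
      ((Fintype.card V : ℝ) - 1) * (((Fintype.card V : ℝ) - 1) / (Fintype.card V - 2)) ^ 3 := by
  have hcard : ((starGraph r).edgeFinset.card : ℝ) = Fintype.card V - 1 := by
    rw [eq_sub_iff_add_eq]
    exact_mod_cast (isTree_starGraph r).card_edgeFinset
  rw [augmentedZagrebIndex_eq_sum, Finset.sum_eq_card_nsmul fun e he =>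
    augmentedZagrebWeight_starGraph (mem_edgeFinset.1 he), nsmul_eq_mul, hcard]

theorem le_augmentedZagrebIndex (hG : G.Connected) (hV : 3 ≤ Fintype.card V) :
    ((Fintype.card V : ℝ) - 1) * (((Fintype.card V : ℝ) - 1) / (Fintype.card V - 2)) ^ 3 ≤
      augmentedZagrebIndex G := by
  have hV' : (3 : ℝ) ≤ Fintype.card V := by exact_mod_cast hV
  set c : ℝ := (((Fintype.card V : ℝ) - 1) / (Fintype.card V - 2)) ^ 3
  have hc : 0 ≤ c := pow_nonneg (div_nonneg (by linarith) (by linarith)) 3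
  calc ((Fintype.card V : ℝ) - 1) * c ≤ G.edgeFinset.card * c :=
        mul_le_mul_of_nonneg_right (card_sub_one_le_card_edgeFinset hG) hc
    _ = G.edgeFinset.card • c := (nsmul_eq_mul _ _).symm
    _ ≤ augmentedZagrebIndex G := Finset.card_nsmul_le_sum _ _ _ fun e he =>
        le_augmentedZagrebWeight hG hV (mem_edgeFinset.1 he)

theorem augmentedZagrebIndex_eq_iff_exists_eq_starGraph (hG : G.Connected)
    (hV : 3 ≤ Fintype.card V) :
    augmentedZagrebIndex G =
        ((Fintype.card V : ℝ) - 1) * (((Fintype.card V : ℝ) - 1) / (Fintype.card V - 2)) ^ 3 ↔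
      ∃ z, G = starGraph z := by
  constructor
  · intro heq
    have hV' : (3 : ℝ) ≤ Fintype.card V := by exact_mod_cast hV
    have hc : 0 < (((Fintype.card V : ℝ) - 1) / (Fintype.card V - 2)) ^ 3 :=
      pow_pos (div_pos (by linarith) (by linarith)) 3
    obtain ⟨hcard, hweight⟩ := card_eq_and_forall_eq_of_sum_le hc
      (card_sub_one_le_card_edgeFinset hG)
      (fun e he => le_augmentedZagrebWeight hG hV (mem_edgeFinset.1 he)) heq.le
    have hnontrivial : Nontrivial V := Fintype.one_lt_card_iff_nontrivial.1 (by lia)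
    obtain ⟨u⟩ := hG.nonempty
    obtain ⟨v, huv⟩ := hG.preconnected.exists_adj_of_nontrivial u
    have he : s(u, v) ∈ G.edgeSet := huv
    obtain ⟨z, hz⟩ := exists_isUniversal_of_augmentedZagrebWeight_eq hG hV he
      (hweight _ (mem_edgeFinset.2 he))
    exact ⟨z, eq_starGraph_of_isTree_of_isUniversal (isTree_of_card_edgeFinset_eq hG hcard) hz⟩
  · rintro ⟨z, rfl⟩
    exact augmentedZagrebIndex_starGraph z

end Index

theorem mainTheorem2_general {V : Type*} [Fintype V] [DecidableEq V] (G : SimpleGraph V)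
    [DecidableRel G.Adj] (n : ℕ) (hn : 3 ≤ n) (hV : Fintype.card V = n) (hG : G.Connected) :
    ((n : ℝ) - 1) * (((n : ℝ) - 1) / ((n : ℝ) - 2)) ^ 3 ≤ augmentedZagrebIndex G ∧
      (augmentedZagrebIndex G = ((n : ℝ) - 1) * (((n : ℝ) - 1) / ((n : ℝ) - 2)) ^ 3 ↔
        Nonempty (G ≃g SimpleGraph.starGraph (⟨0, by omega⟩ : Fin n))) := by
  subst hV
  exact ⟨le_augmentedZagrebIndex hG hn,
    (augmentedZagrebIndex_eq_iff_exists_eq_starGraph hG hn).trans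
      (nonempty_iso_starGraph_iff (Fintype.equivFin V) _).symm⟩

theorem mainTheorem2 {V : Type*} [Fintype V] [DecidableEq V] (G : SimpleGraph V)
    [DecidableRel G.Adj] (n : ℕ) (hn : 4 ≤ n) (hV : Fintype.card V = n) (hG : IsCactus G) :
    ((n : ℝ) - 1) * (((n : ℝ) - 1) / ((n : ℝ) - 2)) ^ 3 ≤ augmentedZagrebIndex G ∧
      (augmentedZagrebIndex G = ((n : ℝ) - 1) * (((n : ℝ) - 1) / ((n : ℝ) - 2)) ^ 3 ↔
        Nonempty (G ≃g SimpleGraph.starGraph (⟨0, by omega⟩ : Fin n))) :=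
  mainTheorem2_general G n (by omega) hV hG.1
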